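/- Let $(G_n,C_n)_{n\ge 0}$ be i.i.d. pairs of non-negative random variables (premiums and claims; $G_n$ and $C_n$ need not be independent of each other), and for $z\in\mathbb R$ let $Z_0=z$, $Z_{n+1}=Z_n+G_n-C_n$ be the Cramér–Lundberg surplus process. Write $\mathsf P_z$ for the probability when $Z_0=z$, let $\tau_B=\inf\{n\ge 0: Z_n\in B\}\in\mathbb N_0\cup\{\infty\}$, and put $$\psi(z)=\mathsf P_z\Big\{\inf_{n\ge 0}Z_n<0\Big\},\qquad \phi(z,y)=\mathsf P_z\big\{\tau_{[y,\infty)}<\tau_{(-\infty,0)},\ \tau_{[y,\infty)}<\infty\big\}.$$ Assume: 1. (net profit condition) $\mathsf E G_0,\mathsf E C_0<\infty$ and $a:=\mathsf E G_0-\mathsf E C_0>0$; 2. $F_C(x)=\mathsf P(C_0\le x)<1$ for all $x>0$; 3. $\mathsf E|C_0-G_0|^\gamma<\infty$ for some real $\gamma\ge 2$. Then there is a real number $s_1$ with $\mathsf E\min(G_0-C_0,s_1)\ge\frac23 a$, and for every such $s_1$ and all $z,y>0$, $$|\psi(z)-(1-\phi(z,y))|\le c\,y^{1-\gamma},\qquad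 c=\frac{3\max(c_1,c_2)}{a\gamma}+\frac12 s_3^{\gamma-1},$$ where $s_2=2^{\gamma-1}\frac{\gamma-1}{a}\mathsf E(G_0-C_0)^2$, $s_3=\max(s_1,s_2)$, and $$c_1=\gamma(\gamma-1)2^{\gamma-3}\,\mathsf E\big[C_0^{\gamma-2}(G_0-C_0)^2\big],\qquad c_2=\gamma\,\mathsf E\big[(s_3+C_0)^{\gamma-1}C_0\big]$$ (expectations in $[0,\infty]$, with $0^0=1$). If $G_0$ and $C_0$ are independent, then $c<\infty$. The same bound holds if $[y,\infty)$ is replaced by $(y,\infty)$ in the definition of $\phi$. -/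

import Mathlib

open MeasureTheory ProbabilityTheory

namespace CramerLundberg

variable {Ω : Type*} [MeasurableSpace Ω]

/-- Premiums `G` and claims `C` of a Cramér–Lundberg model: non-negative random variables such that
the pairs `(G n, C n)` are i.i.d. in `n`. No relation between `G n` and `C n` is imposed. -/
structure IsModel (μ : Measure Ω) (G C : ℕ → Ω → ℝ) : Prop where
  measurable_premium : ∀ n, Measurable (G n)
  measurable_claim : ∀ n, Measurable (C n)
  premium_nonneg : ∀ n, ∀ᵐ ω ∂μ, 0 ≤ G n ω
  claim_nonneg : ∀ n, ∀ᵐ ω ∂μ, 0 ≤ C n ω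
  indep : iIndepFun (fun (n : ℕ) (ω : Ω) => (G n ω, C n ω)) μ
  identDistrib : ∀ n, IdentDistrib (fun ω => (G n ω, C n ω)) (fun ω => (G 0 ω, C 0 ω)) μ μ

/-- The surplus process `Z (n+1) = Z n + G n - C n` with initial capital `Z 0 = z`. -/
def surplus (G C : ℕ → Ω → ℝ) (z : ℝ) : ℕ → Ω → ℝ
  | 0 => fun _ => z
  | n + 1 => fun ω => surplus G C z n ω + G n ω - C n ω

/-- The ruin probability `ψ(z) = P_z(inf_n Z_n < 0)`; the infimum is taken in `[-∞, ∞]`. -/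
noncomputable def ruinProb (μ : Measure Ω) (G C : ℕ → Ω → ℝ) (z : ℝ) : ℝ :=
  μ.real {ω | (⨅ n : ℕ, (surplus G C z n ω : EReal)) < 0}

/-- The reach-avoid probability `P(τ_B < τ_{Aᶜ}, τ_B < ∞)` of a process `X`, where `τ_S` is the first
time `n ≥ 0` at which `X` is in `S` (`⊤` if there is none). -/
noncomputable def reachAvoidProb (μ : Measure Ω) (X : ℕ → Ω → ℝ) (A B : Set ℝ) : ℝ :=
  μ.real {ω | hittingAfter X B 0 ω < hittingAfter X Aᶜ 0 ω ∧ hittingAfter X B 0 ω < ⊤}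

/-- The two-barrier ruin probability `φ(z, y)`: the surplus started at `z` reaches `[y, ∞)`, and it
stays in `[0, ∞)` before. -/
noncomputable def twoBarrierProb (μ : Measure Ω) (G C : ℕ → Ω → ℝ) (z y : ℝ) : ℝ :=
  reachAvoidProb μ (surplus G C z) (Set.Ici 0) (Set.Ici y)

/-- The variant of `φ(z, y)` in which the upper barrier has to be exceeded strictly, that is, the
target set is `(y, ∞)`. -/
noncomputable def twoBarrierProbStrict (μ : Measure Ω) (G C : ℕ → Ω → ℝ) (z y : ℝ) : ℝ :=
  reachAvoidProb μ (surplus G C z) (Set.Ici 0) (Set.Ioi y)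

/-- The mean increment `a = E G₀ - E C₀`. -/
noncomputable def meanIncrement (μ : Measure Ω) (G C : ℕ → Ω → ℝ) : ℝ :=
  (∫ ω, G 0 ω ∂μ) - ∫ ω, C 0 ω ∂μ

/-- The net profit condition: `E G₀` and `E C₀` are finite and `a = E G₀ - E C₀ > 0`. -/
structure NetProfit (μ : Measure Ω) (G C : ℕ → Ω → ℝ) : Prop where
  integrable_premium : Integrable (G 0) μ
  integrable_claim : Integrable (C 0) μ
  mean_pos : 0 < meanIncrement μ G C

/-- The requirement on `s₁`: `E min(G₀ - C₀, s₁) ≥ (2/3) a`. -/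
def IsAdmissible (μ : Measure Ω) (G C : ℕ → Ω → ℝ) (s₁ : ℝ) : Prop :=
  2 / 3 * meanIncrement μ G C ≤ ∫ ω, min (G 0 ω - C 0 ω) s₁ ∂μ

/-- `s₂ = 2^(γ-1) ((γ-1)/a) E (G₀ - C₀)²`. -/
noncomputable def s2 (μ : Measure Ω) (G C : ℕ → Ω → ℝ) (γ : ℝ) : ℝ :=
  2 ^ (γ - 1) * ((γ - 1) / meanIncrement μ G C) * ∫ ω, (G 0 ω - C 0 ω) ^ 2 ∂μ

/-- `s₃ = max(s₁, s₂)`. -/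
noncomputable def s3 (μ : Measure Ω) (G C : ℕ → Ω → ℝ) (γ s₁ : ℝ) : ℝ :=
  max s₁ (s2 μ G C γ)

/-- `c₁ = γ (γ-1) 2^(γ-3) E [C₀^(γ-2) (G₀ - C₀)²]`, an expectation in `[0, ∞]`. -/
noncomputable def c1 (μ : Measure Ω) (G C : ℕ → Ω → ℝ) (γ : ℝ) : ENNReal :=
  ENNReal.ofReal (γ * (γ - 1) * 2 ^ (γ - 3)) *
    ∫⁻ ω, ENNReal.ofReal (C 0 ω ^ (γ - 2) * (G 0 ω - C 0 ω) ^ 2) ∂μ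

/-- `c₂ = γ E [(s₃ + C₀)^(γ-1) C₀]`, an expectation in `[0, ∞]`. -/
noncomputable def c2 (μ : Measure Ω) (G C : ℕ → Ω → ℝ) (γ s₁ : ℝ) : ENNReal :=
  ENNReal.ofReal γ *
    ∫⁻ ω, ENNReal.ofReal ((s3 μ G C γ s₁ + C 0 ω) ^ (γ - 1) * C 0 ω) ∂μ

/-- `c = 3 max(c₁, c₂) / (a γ) + (1/2) s₃^(γ-1)`, as an element of `[0, ∞]`. -/
noncomputable def boundConst (μ : Measure Ω) (G C : ℕ → Ω → ℝ) (γ s₁ : ℝ) : ENNReal :=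
  3 * max (c1 μ G C γ) (c2 μ G C γ s₁) / ENNReal.ofReal (meanIncrement μ G C * γ) +
    ENNReal.ofReal (1 / 2 * s3 μ G C γ s₁ ^ (γ - 1))

end CramerLundberg

/-!
Since the surplus drifts to infinity, the events "ruin" and "the upper barrier is not reached before
ruin" disagree, up to a null set, only on paths that reach the barrier and are ruined afterwards. By
the strong Markov property this has at most the probability of ruin from level `y`
(`abs_ruinProb_sub_le`), so everything reduces to a bound `ψ(y) ≤ c y^(1-γ)`
(`ruin_le_boundConst`).

By time reversal, `ψ(y)` is the limit of the tail probabilities `P(W_n > y)` of Lindley's recursion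
`W_(n+1) = (W_n - X_n)⁺`, `W_0 = 0`, with `X_n = G_n - C_n` (`IsIID.measure_ruinBefore`). If
`E V((w - X)⁺) ≤ V(w) + M - f(w)` for all `w ≥ 0`, then summing along the recursion bounds the Cesàro
means of `E f(W_n)` by `M`; as `P(W_n > y)` increases with `n`, this yields `K ψ(y) ≤ M` whenever
`f ≥ K` above `y` (`IsIID.mul_measure_ruin_le`). No stationary law and no moments of `W_n` are
needed, because the argument takes place in `[0, ∞]`.

Two Lyapunov functions are used. For `y ≥ s₃`, `V(w) = w^γ`: above `s₃` a second-order Taylor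
expansion gives the drift `-(γ a / 3) w^(γ-1) + c₁`, since the choice of `s₁` keeps the truncated mean
above `2a/3` and the choice of `s₂` makes the growing part of the quadratic term at most `a/4`
(`lintegral_rpow_lindley_step_le`), while below `s₃` the drift is at most `c₂`. For `y < s₃`,
`V(w) = w²` gives Kingman's bound `2 a y ψ(y) ≤ E X²`, and `E X² / a ≤ s₃ / 2` turns this into the
summand `s₃^(γ-1) / 2` of the constant.
-/

namespace CramerLundberg

/-! ### Random walks, Lindley recursion and time reversal -/

/-- The sequence of random variables `X` is i.i.d. under `μ`. -/
structure IsIID {Ω : Type*} [MeasurableSpace Ω] (μ : Measure Ω) (X : ℕ → Ω → ℝ) : Prop where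
  measurable : ∀ n, Measurable (X n)
  indep : iIndepFun X μ
  identDistrib : ∀ n, IdentDistrib (X n) (X 0) μ μ

/-- Lindley's recursion `W 0 = 0`, `W (n+1) = max (W n - x n) 0` driven by the sequence `x`. -/
def lindley (x : ℕ → ℝ) : ℕ → ℝ
  | 0 => 0
  | n + 1 => max (lindley x n - x n) 0

/-- The event, on path space, that the walk with increments `x` started at `y` is negative at some
time `k ≤ n`. -/
def ruinBefore (y : ℝ) (n : ℕ) : Set (ℕ → ℝ) :=
  {x | ∃ k ≤ n, y + ∑ i ∈ Finset.range k, x i < 0}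

lemma lindley_nonneg (x : ℕ → ℝ) (n : ℕ) : 0 ≤ lindley x n := by
  cases n <;> simp [lindley]

lemma measurable_lindley (n : ℕ) : Measurable (fun x : ℕ → ℝ => lindley x n) := by
  induction n with
  | zero => exact measurable_const
  | succ n ih => exact (ih.sub (measurable_pi_apply n)).max measurable_const

lemma lindley_congr {x x' : ℕ → ℝ} {n : ℕ} (h : ∀ i < n, x i = x' i) :
    lindley x n = lindley x' n := by
  induction n with
  | zero => rfl
  | succ n ih =>
    simp only [lindley, h n (Nat.lt_succ_self n), ih fun i hi => h i (hi.trans (Nat.lt_succ_self n))]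

lemma measurableSet_ruinBefore (y : ℝ) (n : ℕ) : MeasurableSet (ruinBefore y n) := by
  have : ruinBefore y n = ⋃ k ∈ Set.Iic n, {x | y + ∑ i ∈ Finset.range k, x i < 0} := by
    ext x; simp [ruinBefore]
  rw [this]
  refine MeasurableSet.biUnion (Set.to_countable _) fun k _ => ?_
  refine measurableSet_lt (measurable_const.add ?_) measurable_const
  exact Finset.measurable_sum _ fun i _ => measurable_pi_apply i

lemma ruinBefore_mono (y : ℝ) : Monotone (ruinBefore y) := fun _ _ h _ ⟨k, hk, hx⟩ =>
  ⟨k, hk.trans h, hx⟩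

/-- `lindley x n` is the largest drop of the walk from a time `k ≤ n` to the time `n`. -/
lemma lt_lindley_iff {y : ℝ} (hy : 0 ≤ y) (x : ℕ → ℝ) (n : ℕ) :
    y < lindley x n ↔ ∃ k ≤ n, y + ∑ i ∈ Finset.Ico k n, x i < 0 := by
  induction n generalizing y with
  | zero => simp [lindley]
  | succ n ih =>
    have hsum : ∀ k ≤ n, y + ∑ i ∈ Finset.Ico k (n + 1), x i =
        (y + x n) + ∑ i ∈ Finset.Ico k n, x i := by
      intro k hk
      rw [Finset.sum_Ico_succ_top hk]; ring
    have h1 : (∃ k ≤ n + 1, y + ∑ i ∈ Finset.Ico k (n + 1), x i < 0) ↔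
        ∃ k ≤ n, (y + x n) + ∑ i ∈ Finset.Ico k n, x i < 0 := by
      constructor
      · rintro ⟨k, hk, h⟩
        rcases Nat.lt_or_ge n k with h' | h'
        · obtain rfl : k = n + 1 := by omega
          simp at h; linarith
        · exact ⟨k, h', hsum k h' ▸ h⟩
      · rintro ⟨k, hk, h⟩
        exact ⟨k, by omega, (hsum k hk).symm ▸ h⟩
    rw [h1, lindley, lt_max_iff, or_iff_left (not_lt.2 hy), lt_sub_iff_add_lt]
    rcases le_or_gt 0 (y + x n) with h | h
    · exact ih h
    · exact iff_of_true (h.trans_le (lindley_nonneg x n)) ⟨n, le_rfl, by simpa using h⟩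

variable {Ω : Type*} [MeasurableSpace Ω] {μ : Measure Ω} {X : ℕ → Ω → ℝ}

/-- An i.i.d. sequence remains i.i.d. with the same law when its indices are relabelled. -/
lemma IsIID.map_comp [IsProbabilityMeasure μ] (hX : IsIID μ X) {σ : ℕ → ℕ}
    (hσ : Function.Injective σ) :
    μ.map (fun ω i => X (σ i) ω) = μ.map (fun ω i => X i ω) := by
  have h := (hX.indep.precomp hσ).map_fun_eq_infinitePi_map fun i => hX.measurable (σ i)
  rw [h, hX.indep.map_fun_eq_infinitePi_map hX.measurable]
  congr 1
  ext1 i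
  rw [(hX.identDistrib (σ i)).map_eq, (hX.identDistrib i).map_eq]

lemma IsIID.measurable_path (hX : IsIID μ X) : Measurable (fun ω i => X i ω) :=
  measurable_pi_lambda _ hX.measurable

/-- Time reversal: the probability of ruin up to time `n` is a tail probability of Lindley's
recursion at time `n`. -/
lemma IsIID.measure_ruinBefore [IsProbabilityMeasure μ] (hX : IsIID μ X) {y : ℝ} (hy : 0 ≤ y)
    (n : ℕ) :
    μ ((fun ω i => X i ω) ⁻¹' ruinBefore y n) = μ {ω | y < lindley (fun i => X i ω) n} := by
  -- reverse the first `n` indices and keep the others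
  set σ : ℕ → ℕ := fun i => if i < n then n - 1 - i else i with hσ
  have hinj : Function.Injective σ := by
    intro i j hij
    simp only [hσ] at hij
    split_ifs at hij <;> omega
  have hm : Measurable (fun ω i => X (σ i) ω) := measurable_pi_lambda _ fun i => hX.measurable _
  rw [← Measure.map_apply hX.measurable_path (measurableSet_ruinBefore y n), ← hX.map_comp hinj,
    Measure.map_apply hm (measurableSet_ruinBefore y n)]
  congr 1
  ext ω
  rw [Set.mem_ofPred_eq, lt_lindley_iff hy]
  have hsum : ∀ k ≤ n, ∑ i ∈ Finset.range k, X (σ i) ω = ∑ i ∈ Finset.Ico (n - k) n, X i ω := by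
    intro k hk
    have h := Finset.sum_Ico_reflect (fun i => X i ω) 0 (m := k) (n := n - 1) (by omega)
    rcases Nat.eq_zero_or_pos n with rfl | hn
    · obtain rfl : k = 0 := by omega
      simp
    rw [show n - 1 + 1 = n by omega, Nat.sub_zero] at h
    rw [← h, Finset.range_eq_Ico]
    refine Finset.sum_congr rfl fun i hi => ?_
    rw [Finset.mem_Ico] at hi
    simp [hσ, show i < n by omega]
  constructor
  · rintro ⟨k, hk, h⟩
    exact ⟨n - k, Nat.sub_le _ _, by rw [← hsum k hk]; exact h⟩
  · rintro ⟨k, hk, h⟩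
    refine ⟨n - k, Nat.sub_le _ _, ?_⟩
    rw [hsum (n - k) (Nat.sub_le _ _), Nat.sub_sub_self hk]
    exact h

/-- Disjoint blocks of an independent sequence are independent; a block is encoded as the sequence
that vanishes off it. -/
lemma indepFun_indicator_of_disjoint (hm : ∀ n, Measurable (X n)) (hX : iIndepFun X μ)
    {S T : Set ℕ} (hST : Disjoint S T) :
    IndepFun (fun ω => S.indicator fun i => X i ω) (fun ω => T.indicator fun i => X i ω) μ := by
  have hle : ∀ U : Set ℕ, MeasurableSpace.comap (fun ω => U.indicator fun i => X i ω)
      MeasurableSpace.pi ≤ ⨆ i ∈ U, MeasurableSpace.comap (X i) inferInstance := by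
    intro U
    rw [← measurable_iff_comap_le]
    refine @measurable_pi_lambda _ _ _ (_) _ _ fun i => ?_
    by_cases hi : i ∈ U
    · simp only [Set.indicator_of_mem hi]
      exact (comap_measurable (X i)).mono (le_iSup₂_of_le i hi le_rfl) le_rfl
    · simp only [Set.indicator_of_notMem hi]
      exact @measurable_const _ _ _ (_) _
  rw [IndepFun_iff_Indep]
  exact indep_of_indep_of_le_left (indep_of_indep_of_le_right
    (indep_iSup_of_disjoint (fun i => (hm i).comap_le) hX.iIndep hST) (hle T)) (hle S)

/-- The law of Lindley's recursion after one more step. -/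
lemma IsIID.lintegral_lindley_succ [IsProbabilityMeasure μ] (hX : IsIID μ X)
    {V : ℝ → ENNReal} (hV : Measurable V) (n : ℕ) :
    ∫⁻ ω, V (lindley (fun i => X i ω) (n + 1)) ∂μ =
      ∫⁻ ω, ∫⁻ ω', V (max (lindley (fun i => X i ω) n - X 0 ω') 0) ∂μ ∂μ := by
  have hW : Measurable (fun ω => lindley (fun i => X i ω) n) :=
    (measurable_lindley n).comp hX.measurable_path
  have hind : IndepFun (fun ω => lindley (fun i => X i ω) n) (X n) μ := by
    have h := (indepFun_indicator_of_disjoint hX.measurable hX.indep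
      (S := Set.Iio n) (T := {n}) (by simp)).comp (measurable_lindley n) (measurable_pi_apply n)
    refine h.congr (Filter.EventuallyEq.of_eq ?_) (Filter.EventuallyEq.of_eq ?_)
    · ext ω
      exact lindley_congr fun i hi => Set.indicator_of_mem (Set.mem_Iio.2 hi) _
    · ext ω
      simp
  have hF : Measurable (fun p : ℝ × ℝ => V (max (p.1 - p.2) 0)) :=
    hV.comp ((measurable_fst.sub measurable_snd).max measurable_const)
  have hprod := (indepFun_iff_map_prod_eq_prod_map_map hW.aemeasurable
    (hX.measurable n).aemeasurable).1 hind
  calc ∫⁻ ω, V (lindley (fun i => X i ω) (n + 1)) ∂μ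
      = ∫⁻ p, V (max (p.1 - p.2) 0)
          ∂(μ.map fun ω => (lindley (fun i => X i ω) n, X n ω)) := by
        rw [lintegral_map hF (hW.prodMk (hX.measurable n))]; rfl
    _ = ∫⁻ w, ∫⁻ x, V (max (w - x) 0) ∂(μ.map (X 0))
          ∂(μ.map fun ω => lindley (fun i => X i ω) n) := by
        rw [hprod, (hX.identDistrib n).map_eq]
        have := Measure.isProbabilityMeasure_map (hX.measurable 0).aemeasurable (μ := μ)
        rw [lintegral_prod _ hF.aemeasurable]
    _ = _ := by
        have := Measure.isProbabilityMeasure_map (hX.measurable 0).aemeasurable (μ := μ)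
        rw [lintegral_map hF.lintegral_prod_right' hW]
        refine lintegral_congr fun ω => ?_
        exact lintegral_map (hF.comp measurable_prodMk_left) (hX.measurable 0)

/-! ### Ruin bounds from a drift condition -/

/-- Foster–Lyapunov bound. If `V` has drift at most `M - f` along Lindley's recursion, then in the
long run the mean of `f` is at most `M`, which bounds the tail of the recursion and hence, by time
reversal, the probability of ruin. -/
theorem IsIID.mul_measure_ruin_le [IsProbabilityMeasure μ] (hX : IsIID μ X)
    {V f : ℝ → ENNReal} (hV : Measurable V) (hf : Measurable f) (hV0 : V 0 = 0) {M : ENNReal}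
    (hdrift : ∀ w, 0 ≤ w → ∫⁻ ω, V (max (w - X 0 ω) 0) ∂μ + f w ≤ V w + M)
    {y : ℝ} (hy : 0 ≤ y) {K : ENNReal} (hK : ∀ w, y < w → K ≤ f w) :
    K * μ {ω | ∃ k, y + ∑ i ∈ Finset.range k, X i ω < 0} ≤ M := by
  set W : ℕ → Ω → ℝ := fun n ω => lindley (fun i => X i ω) n with hWdef
  have hW : ∀ n, Measurable (W n) := fun n => (measurable_lindley n).comp hX.measurable_path
  set p : ℕ → ENNReal := fun n => μ ((fun ω i => X i ω) ⁻¹' ruinBefore y n) with hp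
  have hpmono : Monotone p := fun m n h => measure_mono (Set.preimage_mono (ruinBefore_mono y h))
  have hstep : ∀ n, ∫⁻ ω, V (W (n + 1) ω) ∂μ + K * p n ≤ ∫⁻ ω, V (W n ω) ∂μ + M := by
    intro n
    have h1 : K * p n ≤ ∫⁻ ω, f (W n ω) ∂μ := by
      rw [hp]
      simp only
      rw [hX.measure_ruinBefore hy n]
      have hs : MeasurableSet {ω | y < W n ω} := measurableSet_lt measurable_const (hW n)
      rw [← lintegral_indicator_const hs]
      refine lintegral_mono fun ω => Set.indicator_le' (fun ω hω => hK _ hω) (fun _ _ => zero_le) ω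
    calc ∫⁻ ω, V (W (n + 1) ω) ∂μ + K * p n
        ≤ ∫⁻ ω, (∫⁻ ω', V (max (W n ω - X 0 ω') 0) ∂μ) ∂μ + ∫⁻ ω, f (W n ω) ∂μ := by
          rw [hX.lintegral_lindley_succ hV n]
          gcongr
      _ = ∫⁻ ω, (∫⁻ ω', V (max (W n ω - X 0 ω') 0) ∂μ) + f (W n ω) ∂μ :=
          (lintegral_add_right _ (hf.comp (hW n))).symm
      _ ≤ ∫⁻ ω, V (W n ω) + M ∂μ := lintegral_mono fun ω => hdrift _ (lindley_nonneg _ _)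
      _ = _ := by rw [lintegral_add_right _ measurable_const]; simp
  have hsum : ∀ n : ℕ, ∫⁻ ω, V (W n ω) ∂μ + ∑ k ∈ Finset.range n, K * p k ≤ n * M := by
    intro n
    induction n with
    | zero => simp [hWdef, lindley, hV0]
    | succ n ih =>
      calc ∫⁻ ω, V (W (n + 1) ω) ∂μ + ∑ k ∈ Finset.range (n + 1), K * p k
          = (∫⁻ ω, V (W (n + 1) ω) ∂μ + K * p n) + ∑ k ∈ Finset.range n, K * p k := by
            rw [Finset.sum_range_succ]; ring
        _ ≤ (∫⁻ ω, V (W n ω) ∂μ + M) + ∑ k ∈ Finset.range n, K * p k := by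
            gcongr ?_ + _
            exact hstep n
        _ = (∫⁻ ω, V (W n ω) ∂μ + ∑ k ∈ Finset.range n, K * p k) + M := by ring
        _ ≤ n * M + M := by gcongr
        _ = _ := by push_cast; ring
  -- a Cesàro mean over `m + j` steps contains `j` terms at least `K * p m`; then `j → ∞`
  have hpm : ∀ m, K * p m ≤ M := by
    intro m
    have h1 : ∀ j : ℕ, (j : ENNReal) * (K * p m) ≤ ((m + j : ℕ) : ENNReal) * M := by
      intro j
      calc (j : ENNReal) * (K * p m) = ∑ k ∈ Finset.Ico m (m + j), K * p m := by simp
        _ ≤ ∑ k ∈ Finset.Ico m (m + j), K * p k := by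
            refine Finset.sum_le_sum fun k hk => ?_
            gcongr
            exact hpmono (Finset.mem_Ico.1 hk).1
        _ ≤ ∑ k ∈ Finset.range (m + j), K * p k := by
            refine Finset.sum_le_sum_of_subset fun k hk => ?_
            simp at hk ⊢; omega
        _ ≤ _ := le_trans le_add_self (hsum (m + j))
    rcases eq_or_ne M ⊤ with rfl | hM
    · exact le_top
    have hfin : K * p m ≠ ⊤ := by
      have h2 := h1 1
      rw [Nat.cast_one, one_mul] at h2
      exact ne_top_of_le_ne_top (ENNReal.mul_ne_top (ENNReal.natCast_ne_top _) hM) h2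
    rw [← ENNReal.toReal_le_toReal hfin hM]
    refine le_of_forall_pos_lt_add fun ε hε => ?_
    by_contra! hcon
    obtain ⟨j, hj⟩ := exists_nat_gt (m * M.toReal / ε)
    have h2 := ENNReal.toReal_mono (ENNReal.mul_ne_top (ENNReal.natCast_ne_top _) hM) (h1 j)
    rw [ENNReal.toReal_mul (b := K * p m), ENNReal.toReal_mul (b := M), ENNReal.toReal_natCast,
      ENNReal.toReal_natCast] at h2
    push_cast at h2
    rw [div_lt_iff₀ hε] at hj
    have h3 := mul_le_mul_of_nonneg_left hcon (Nat.cast_nonneg (α := ℝ) j)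
    nlinarith
  have hunion : {ω | ∃ k, y + ∑ i ∈ Finset.range k, X i ω < 0} =
      ⋃ n, (fun ω i => X i ω) ⁻¹' ruinBefore y n := by
    ext ω
    simp only [Set.mem_ofPred_eq, Set.mem_iUnion, Set.mem_preimage, ruinBefore]
    exact ⟨fun ⟨k, h⟩ => ⟨k, k, le_rfl, h⟩, fun ⟨_, k, _, h⟩ => ⟨k, h⟩⟩
  rw [hunion, Monotone.measure_iUnion fun m n h => Set.preimage_mono (ruinBefore_mono y h),
    ENNReal.mul_iSup]
  exact iSup_le hpm

end CramerLundberg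

namespace CramerLundberg

/-! ### Reaching an upper level before ruin -/

lemma surplus_eq_add_sum {Ω : Type*} (G C : ℕ → Ω → ℝ) (z : ℝ) (n : ℕ) (ω : Ω) :
    surplus G C z n ω = z + ∑ i ∈ Finset.range n, (G i ω - C i ω) := by
  induction n with
  | zero => simp [surplus]
  | succ n ih =>
    simp only [surplus]
    rw [ih, Finset.sum_range_succ]; ring

lemma reachAvoid_iff {Ω β : Type*} (Z : ℕ → Ω → β) (A B : Set β) (ω : Ω) :
    (hittingAfter Z B 0 ω < hittingAfter Z Aᶜ 0 ω ∧ hittingAfter Z B 0 ω < ⊤) ↔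
      ∃ n, Z n ω ∈ B ∧ ∀ k ≤ n, Z k ω ∈ A := by
  constructor
  · rintro ⟨h1, h2⟩
    refine ⟨_, hittingAfter_mem_set_of_ne_top h2.ne, fun k hk => ?_⟩
    by_contra hkA
    have h3 : hittingAfter Z Aᶜ 0 ω ≤ WithTop.some k := hittingAfter_le_of_mem (Nat.zero_le k) hkA
    lift hittingAfter Z B 0 ω to ℕ using h2.ne with m hm
    have h4 : k ≤ m := hk
    exact absurd (h1.trans_le h3) (not_lt.2 (WithTop.coe_le_coe.2 h4))
  · rintro ⟨n, hn, hA⟩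
    have h1 : hittingAfter Z B 0 ω ≤ WithTop.some n := hittingAfter_le_of_mem (Nat.zero_le n) hn
    have h2 : WithTop.some n < hittingAfter Z Aᶜ 0 ω := by
      rw [← not_le, hittingAfter_le_iff]
      rintro ⟨j, hj, hjA⟩
      exact hjA (hA j hj.2)
    exact ⟨h1.trans_lt h2, h1.trans_lt (WithTop.coe_lt_top n)⟩

lemma iInf_coe_lt_zero_iff (u : ℕ → ℝ) : (⨅ n, (u n : EReal)) < 0 ↔ ∃ n, u n < 0 := by
  rw [iInf_lt_iff]
  exact exists_congr fun n => by exact_mod_cast Iff.rfl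

variable {Ω : Type*} [MeasurableSpace Ω] {μ : Measure Ω} {X : ℕ → Ω → ℝ}

lemma IsIID.ae_exists_lt_sum (hX : IsIID μ X) (hint : Integrable (X 0) μ)
    (hpos : 0 < ∫ ω, X 0 ω ∂μ) (b : ℝ) :
    ∀ᵐ ω ∂μ, ∃ n, b < ∑ i ∈ Finset.range n, X i ω := by
  have h := strong_law_ae_real X hint (fun i j hij => hX.indep.indepFun hij) hX.identDistrib
  filter_upwards [h] with ω hω
  have htop : Filter.Tendsto (fun n : ℕ => (∑ i ∈ Finset.range n, X i ω) / n * n)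
      Filter.atTop Filter.atTop := hω.pos_mul_atTop hpos tendsto_natCast_atTop_atTop
  obtain ⟨n, hn, hn0⟩ := ((htop.eventually_gt_atTop b).and
    (Filter.eventually_gt_atTop 0)).exists
  refine ⟨n, ?_⟩
  rwa [div_mul_cancel₀ _ (by positivity)] at hn

/-- Strong Markov property at the first entrance into a set `B` above the level `y`: the walk has
to fall below zero after it has been at or above `y`, which has at most the probability of ruin from
`y`. -/
lemma IsIID.measure_reach_then_ruin_le [IsProbabilityMeasure μ] (hX : IsIID μ X) (z y : ℝ)
    {B : Set ℝ} (hB : MeasurableSet B) (hBy : B ⊆ Set.Ici y) :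
    μ {ω | ∃ n, z + ∑ i ∈ Finset.range n, X i ω ∈ B ∧
        ∃ k, z + ∑ i ∈ Finset.range (n + k), X i ω < 0} ≤
      μ {ω | ∃ k, y + ∑ i ∈ Finset.range k, X i ω < 0} := by
  set Tp : ℕ → Set (ℕ → ℝ) := fun m => {x | z + ∑ i ∈ Finset.range m, x i ∈ B ∧
    ∀ j < m, z + ∑ i ∈ Finset.range j, x i ∉ B} with hTp
  set Rp : Set (ℕ → ℝ) := {x | ∃ k, y + ∑ i ∈ Finset.range k, x i < 0} with hRp
  have hmsum : ∀ (c : ℝ) (m : ℕ), Measurable fun x : ℕ → ℝ => c + ∑ i ∈ Finset.range m, x i :=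
    fun c m => measurable_const.add (Finset.measurable_sum _ fun i _ => measurable_pi_apply i)
  have hTm : ∀ m, MeasurableSet (Tp m) := by
    intro m
    have : Tp m = {x | z + ∑ i ∈ Finset.range m, x i ∈ B} ∩
        ⋂ j ∈ Set.Iio m, {x | z + ∑ i ∈ Finset.range j, x i ∉ B} := by
      ext x; simp [hTp]
    rw [this]
    exact (hmsum z m hB).inter
      (MeasurableSet.biInter (Set.to_countable _) fun j _ => (hmsum z j hB).compl)
  have hRm : MeasurableSet Rp := by
    have : Rp = ⋃ k, {x | y + ∑ i ∈ Finset.range k, x i < 0} := by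
      ext x; simp [hRp]
    rw [this]
    exact MeasurableSet.iUnion fun k => measurableSet_lt (hmsum y k) measurable_const
  set T : ℕ → Set Ω := fun m => (fun ω i => X i ω) ⁻¹' Tp m with hT
  set R : ℕ → Set Ω := fun m => (fun ω i => X (m + i) ω) ⁻¹' Rp with hR
  have hsub : {ω | ∃ n, z + ∑ i ∈ Finset.range n, X i ω ∈ B ∧
      ∃ k, z + ∑ i ∈ Finset.range (n + k), X i ω < 0} ⊆ ⋃ m, T m ∩ R m := by
    rintro ω ⟨n, hn, k, hk⟩
    classical
    -- the first entrance into `B` is no later than the given visit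
    have hex : ∃ n, z + ∑ i ∈ Finset.range n, X i ω ∈ B := ⟨n, hn⟩
    have hle : Nat.find hex ≤ n := Nat.find_min' hex hn
    refine Set.mem_iUnion.2 ⟨Nat.find hex, ⟨Nat.find_spec hex, fun j hj => Nat.find_min hex hj⟩,
      n + k - Nat.find hex, ?_⟩
    have h1 : y ≤ z + ∑ i ∈ Finset.range (Nat.find hex), X i ω := hBy (Nat.find_spec hex)
    have h2 := Finset.sum_range_add (fun i => X i ω) (Nat.find hex) (n + k - Nat.find hex)
    rw [Nat.add_sub_cancel' (by omega)] at h2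
    linarith
  have hind : ∀ m, μ (T m ∩ R m) = μ (T m) * μ (R m) := by
    intro m
    have hshift : Measurable fun x : ℕ → ℝ => fun i => x (m + i) :=
      measurable_pi_lambda _ fun i => measurable_pi_apply _
    have h := (indepFun_indicator_of_disjoint hX.measurable hX.indep
      (S := Set.Iio m) (T := Set.Ici m)
      (Set.disjoint_left.2 fun i hi hi' => not_le.2 (Set.mem_Iio.1 hi) hi')).measure_inter_preimage_eq_mul
        _ _ (hTm m) (hshift hRm)
    have hTe : (fun ω => (Set.Iio m).indicator fun i => X i ω) ⁻¹' Tp m = T m := by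
      ext ω
      have hs : ∀ j ≤ m, ∑ i ∈ Finset.range j, (Set.Iio m).indicator (fun i => X i ω) i =
          ∑ i ∈ Finset.range j, X i ω := fun j hj => Finset.sum_congr rfl fun i hi =>
        Set.indicator_of_mem (Set.mem_Iio.2 ((Finset.mem_range.1 hi).trans_le hj)) _
      simp only [hT, hTp, Set.mem_preimage, Set.mem_ofPred_eq, hs m le_rfl]
      exact and_congr_right fun _ => forall₂_congr fun j hj => by rw [hs j hj.le]
    have hRe : (fun ω => (Set.Ici m).indicator fun i => X i ω) ⁻¹'
        ((fun x : ℕ → ℝ => fun i => x (m + i)) ⁻¹' Rp) = R m := by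
      ext ω
      simp only [hR, Set.mem_preimage]
      rw [show (fun i => (Set.Ici m).indicator (fun i => X i ω) (m + i)) = fun i => X (m + i) ω from
        funext fun i => Set.indicator_of_mem (Set.mem_Ici.2 (Nat.le_add_right m i)) _]
    rwa [hTe, hRe] at h
  have hRβ : ∀ m, μ (R m) = μ {ω | ∃ k, y + ∑ i ∈ Finset.range k, X i ω < 0} := by
    intro m
    rw [hR]
    simp only
    rw [← Measure.map_apply (measurable_pi_lambda _ fun i => hX.measurable _) hRm,
      hX.map_comp (add_right_injective m), Measure.map_apply hX.measurable_path hRm]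
    rfl
  have hdisj : Pairwise (Function.onFun Disjoint T) := by
    intro m n hmn
    refine Set.disjoint_left.2 fun ω hm hn => ?_
    rcases lt_or_gt_of_ne hmn with h | h
    · exact hn.2 m h hm.1
    · exact hm.2 n h hn.1
  calc _ ≤ μ (⋃ m, T m ∩ R m) := measure_mono hsub
    _ ≤ ∑' m, μ (T m ∩ R m) := measure_iUnion_le _
    _ = (∑' m, μ (T m)) * μ {ω | ∃ k, y + ∑ i ∈ Finset.range k, X i ω < 0} := by
        simp_rw [hind, hRβ]
        exact ENNReal.tsum_mul_right
    _ = μ (⋃ m, T m) * μ {ω | ∃ k, y + ∑ i ∈ Finset.range k, X i ω < 0} := by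
        rw [measure_iUnion hdisj fun m => hX.measurable_path (hTm m)]
    _ ≤ 1 * _ := by gcongr; exact prob_le_one
    _ = _ := one_mul _

/-- The ruin probability and the complement of the two-barrier probability differ by at most the
ruin probability from the upper barrier: the two events can disagree only if the walk reaches `B`
and falls below zero afterwards, or if it stays below `B` forever, and the latter has probability
zero. -/
lemma abs_ruinProb_sub_le [IsProbabilityMeasure μ] {G C : ℕ → Ω → ℝ}
    (hX : IsIID μ fun n ω => G n ω - C n ω) (hint : Integrable (fun ω => G 0 ω - C 0 ω) μ)
    (hpos : 0 < ∫ ω, (G 0 ω - C 0 ω) ∂μ) (z y : ℝ) {B : Set ℝ} (hB : MeasurableSet B)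
    (hBy : B ⊆ Set.Ici y) (hyB : Set.Ioi y ⊆ B) :
    ENNReal.ofReal |ruinProb μ G C z -
        (1 - reachAvoidProb μ (surplus G C z) (Set.Ici 0) B)| ≤
      μ {ω | ∃ k, y + ∑ i ∈ Finset.range k, (G i ω - C i ω) < 0} := by
  set Z : ℕ → Ω → ℝ := fun n ω => z + ∑ i ∈ Finset.range n, (G i ω - C i ω) with hZ
  have hZm : ∀ n, Measurable (Z n) := fun n =>
    measurable_const.add (Finset.measurable_sum _ fun i _ => hX.measurable i)
  set R : Set Ω := {ω | ∃ n, Z n ω < 0} with hR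
  set H : Set Ω := {ω | ∃ n, Z n ω ∈ B ∧ ∀ k ≤ n, 0 ≤ Z k ω} with hH
  have hψ : ruinProb μ G C z = μ.real R := by
    unfold ruinProb
    congr 1
    ext ω
    simp only [hR, Set.mem_ofPred_eq]
    rw [iInf_coe_lt_zero_iff fun n => surplus G C z n ω]
    simp only [surplus_eq_add_sum, hZ]
  have hφ : reachAvoidProb μ (surplus G C z) (Set.Ici 0) B = μ.real H := by
    unfold reachAvoidProb
    congr 1
    ext ω
    simp only [hH, Set.mem_ofPred_eq]
    rw [reachAvoid_iff]
    simp only [surplus_eq_add_sum, hZ, Set.mem_Ici]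
  have hHm : MeasurableSet H := by
    have : H = ⋃ n, Z n ⁻¹' B ∩ ⋂ k ∈ Set.Iic n, Z k ⁻¹' Set.Ici 0 := by
      ext ω; simp [hH]
    rw [this]
    exact MeasurableSet.iUnion fun n => (hZm n hB).inter
      (MeasurableSet.biInter (Set.to_countable _) fun k _ => hZm k measurableSet_Ici)
  rw [hψ, hφ, ← probReal_compl_eq_one_sub hHm]
  set b := μ {ω | ∃ k, y + ∑ i ∈ Finset.range k, (G i ω - C i ω) < 0}
  have hb : b ≠ ⊤ := measure_ne_top _ _
  have h1 : μ (R ∩ H) ≤ b := by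
    refine le_trans (measure_mono ?_) (hX.measure_reach_then_ruin_le z y hB hBy)
    rintro ω ⟨⟨m, hm⟩, n, hn, hk⟩
    refine ⟨n, hn, m - n, ?_⟩
    have hnm : n < m := by
      by_contra! h
      exact absurd hm (not_lt.2 (hk m h))
    rwa [Nat.add_sub_cancel' hnm.le]
  have h2 : μ (Hᶜ \ R) = 0 := by
    refine measure_mono_null (t := {ω | ¬ ∃ n, y - z < ∑ i ∈ Finset.range n, (G i ω - C i ω)}) ?_
      (hX.ae_exists_lt_sum hint hpos (y - z))
    rintro ω ⟨hω, hωR⟩ ⟨n, hn⟩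
    refine hω ⟨n, hyB (Set.mem_Ioi.2 (by simp only [hZ]; linarith)), fun k _ => ?_⟩
    by_contra! h
    exact hωR ⟨k, h⟩
  have h3 : μ.real R ≤ μ.real Hᶜ + b.toReal := by
    calc μ.real R ≤ μ.real (Hᶜ ∪ R ∩ H) := measureReal_mono fun ω hω => by
          by_cases h : ω ∈ H
          · exact Or.inr ⟨hω, h⟩
          · exact Or.inl h
      _ ≤ μ.real Hᶜ + μ.real (R ∩ H) := measureReal_union_le _ _
      _ ≤ _ := by gcongr; exact ENNReal.toReal_mono hb h1
  have h4 : μ.real Hᶜ ≤ μ.real R := by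
    calc μ.real Hᶜ ≤ μ.real (R ∪ Hᶜ \ R) := measureReal_mono fun ω hω => by
          by_cases h : ω ∈ R
          · exact Or.inl h
          · exact Or.inr ⟨hω, h⟩
      _ ≤ μ.real R + μ.real (Hᶜ \ R) := measureReal_union_le _ _
      _ = μ.real R := by rw [measureReal_def, measureReal_def, h2]; simp
  refine ENNReal.ofReal_le_of_le_toReal ?_
  rw [abs_of_nonneg (by linarith)]
  linarith

end CramerLundberg

namespace CramerLundberg

/-! ### Inequalities for real powers -/

lemma rpow_sub_rpow_le {x y p : ℝ} (hx : 0 ≤ x) (hy : 0 ≤ y) (hp : 1 ≤ p) :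
    x ^ p - y ^ p ≤ p * x ^ (p - 1) * (x - y) := by
  rcases hx.eq_or_lt with rfl | hx
  · rcases hp.eq_or_lt with rfl | hp
    · simp
    · rw [Real.zero_rpow (by linarith), Real.zero_rpow (by linarith)]
      have := Real.rpow_nonneg hy p
      linarith
  · have h := one_add_mul_self_le_rpow_one_add (s := y / x - 1)
      (by have := div_nonneg hy hx.le; linarith) hp
    rw [add_sub_cancel, Real.div_rpow hy hx.le, le_div_iff₀ (Real.rpow_pos_of_pos hx p)] at h
    have h1 : x ^ p = x ^ (p - 1) * x := by
      rw [← Real.rpow_add_one hx.ne']; simp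
    have h2 : (1 + p * (y / x - 1)) * x ^ p = x ^ p + p * x ^ (p - 1) * (y - x) := by
      rw [h1]; field_simp
    linarith

/-- Second-order Taylor bound for `t ↦ t ^ γ` at `w`, with the second derivative replaced by its
value at an upper bound `m` of both points. -/
lemma rpow_le_taylor {u w m γ : ℝ} (hγ : 2 ≤ γ) (hu : 0 ≤ u) (hw : 0 ≤ w) (hum : u ≤ m)
    (hwm : w ≤ m) :
    u ^ γ ≤ w ^ γ + γ * w ^ (γ - 1) * (u - w) +
      γ * (γ - 1) / 2 * m ^ (γ - 2) * (u - w) ^ 2 := by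
  set g : ℝ → ℝ := fun t => w ^ γ + γ * w ^ (γ - 1) * (t - w) +
      γ * (γ - 1) / 2 * m ^ (γ - 2) * (t - w) ^ 2 - t ^ γ with hg
  have hd : ∀ t, HasDerivAt g (γ * w ^ (γ - 1) +
      γ * (γ - 1) * m ^ (γ - 2) * (t - w) - γ * t ^ (γ - 1)) t := by
    intro t
    have h1 : HasDerivAt (fun t : ℝ => t - w) 1 t := (hasDerivAt_id t).sub_const w
    have h2 := (((h1.const_mul (γ * w ^ (γ - 1))).const_add (w ^ γ)).add
      ((h1.pow 2).const_mul (γ * (γ - 1) / 2 * m ^ (γ - 2)))).sub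
        (Real.hasDerivAt_rpow_const (x := t) (p := γ) (Or.inr (by linarith)))
    refine h2.congr_deriv ?_
    push_cast
    ring
  have hcont : Continuous g := continuous_iff_continuousAt.2 fun t => (hd t).continuousAt
  have hgw : g w = 0 := by simp [hg]
  have hpm : ∀ t, 0 ≤ t → t ≤ m → t ^ (γ - 2) ≤ m ^ (γ - 2) := fun t h0 h1 =>
    Real.rpow_le_rpow h0 h1 (by linarith)
  have hc : 0 ≤ γ * (γ - 1) := by nlinarith
  have hγ0 : 0 ≤ γ := by linarith
  suffices h : 0 ≤ g u by
    simp only [hg] at h; linarith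
  rw [← hgw]
  rcases le_total w u with h | h
  · refine monotoneOn_of_deriv_nonneg (convex_Icc w m) hcont.continuousOn
      (fun t _ => (hd t).differentiableAt.differentiableWithinAt) ?_ ⟨le_rfl, hwm⟩ ⟨h, hum⟩ h
    intro t ht
    rw [interior_Icc] at ht
    rw [(hd t).deriv]
    have h1 := rpow_sub_rpow_le (hw.trans ht.1.le) hw (p := γ - 1) (by linarith)
    rw [show γ - 1 - 1 = γ - 2 by ring] at h1
    have h2 : γ * (γ - 1) * t ^ (γ - 2) * (t - w) ≤ γ * (γ - 1) * m ^ (γ - 2) * (t - w) := by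
      have := hpm t (hw.trans ht.1.le) ht.2.le
      have := ht.1
      gcongr
    nlinarith [mul_le_mul_of_nonneg_left h1 hγ0]
  · refine antitoneOn_of_deriv_nonpos (convex_Icc 0 w) hcont.continuousOn
      (fun t _ => (hd t).differentiableAt.differentiableWithinAt) ?_ ⟨hu, h⟩ ⟨hw, le_rfl⟩ h
    intro t ht
    rw [interior_Icc] at ht
    rw [(hd t).deriv]
    have h1 := rpow_sub_rpow_le hw ht.1.le (p := γ - 1) (by linarith)
    rw [show γ - 1 - 1 = γ - 2 by ring] at h1
    have h2 : γ * (γ - 1) * w ^ (γ - 2) * (w - t) ≤ γ * (γ - 1) * m ^ (γ - 2) * (w - t) := by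
      have := hpm w hw hwm
      have := ht.2
      gcongr
    nlinarith [mul_le_mul_of_nonneg_left h1 hγ0]

lemma add_rpow_le_two_rpow_mul {x y q : ℝ} (hx : 0 ≤ x) (hy : 0 ≤ y) (hq : 0 ≤ q) :
    (x + y) ^ q ≤ 2 ^ q * (x ^ q + y ^ q) := by
  have h : ∀ t, 0 ≤ t → x + y ≤ 2 * t → (x + y) ^ q ≤ 2 ^ q * t ^ q := fun t ht h => by
    rw [← Real.mul_rpow zero_le_two ht]
    exact Real.rpow_le_rpow (by positivity) h hq
  have h2 : (0 : ℝ) ≤ 2 ^ q := by positivity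
  rcases le_total x y with hxy | hxy
  · refine (h y hy (by linarith)).trans (mul_le_mul_of_nonneg_left ?_ h2)
    linarith [Real.rpow_nonneg hx q]
  · refine (h x hx (by linarith)).trans (mul_le_mul_of_nonneg_left ?_ h2)
    linarith [Real.rpow_nonneg hy q]

/-! ### Drift of powers along Lindley's recursion -/

variable {Ω : Type*} [MeasurableSpace Ω] {μ : Measure Ω}

lemma lintegral_ofReal_le_ofReal_integral {f g : Ω → ℝ} (hg : Integrable g μ)
    (hf : ∀ ω, 0 ≤ f ω) (hfg : ∀ᵐ ω ∂μ, f ω ≤ g ω) :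
    ∫⁻ ω, ENNReal.ofReal (f ω) ∂μ ≤ ENNReal.ofReal (∫ ω, g ω ∂μ) := by
  rw [ofReal_integral_eq_lintegral_ofReal hg (hfg.mono fun ω h => (hf ω).trans h)]
  exact lintegral_mono_ae (hfg.mono fun ω h => ENNReal.ofReal_le_ofReal h)

lemma integrable_sq_of_integrable_abs_rpow [IsFiniteMeasure μ] {Y : Ω → ℝ} (hm : Measurable Y)
    {γ : ℝ} (hγ : 2 ≤ γ) (h : Integrable (fun ω => |Y ω| ^ γ) μ) :
    Integrable (fun ω => Y ω ^ 2) μ := by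
  refine ((integrable_const (1 : ℝ)).add h).mono' (hm.pow_const 2).aestronglyMeasurable
    (Filter.Eventually.of_forall fun ω => ?_)
  rw [Real.norm_of_nonneg (sq_nonneg _), ← sq_abs, Pi.add_apply]
  have h0 := abs_nonneg (Y ω)
  rcases le_total |Y ω| 1 with h1 | h1
  · have := Real.rpow_nonneg h0 γ
    nlinarith
  · have := Real.rpow_le_rpow_of_exponent_le h1 hγ
    rw [Real.rpow_two] at this
    linarith

lemma lintegral_sq_lindley_step_le [IsProbabilityMeasure μ] {Y : Ω → ℝ} (hY : Integrable Y μ)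
    (hY2 : Integrable (fun ω => Y ω ^ 2) μ) (hpos : 0 ≤ ∫ ω, Y ω ∂μ) {w : ℝ} (hw : 0 ≤ w) :
    ∫⁻ ω, ENNReal.ofReal (max (w - Y ω) 0 ^ 2) ∂μ + ENNReal.ofReal (2 * (∫ ω, Y ω ∂μ) * w) ≤
      ENNReal.ofReal (w ^ 2) + ENNReal.ofReal (∫ ω, Y ω ^ 2 ∂μ) := by
  have hint : Integrable (fun ω => w ^ 2 - 2 * w * Y ω + Y ω ^ 2) μ :=
    ((integrable_const _).sub (hY.const_mul _)).add hY2
  have h0 : 0 ≤ ∫ ω, w ^ 2 - 2 * w * Y ω + Y ω ^ 2 ∂μ :=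
    integral_nonneg fun ω => by simp only [Pi.zero_apply]; nlinarith [sq_nonneg (w - Y ω)]
  have h1 := lintegral_ofReal_le_ofReal_integral (f := fun ω => max (w - Y ω) 0 ^ 2) hint
    (fun ω => sq_nonneg _) (Filter.Eventually.of_forall fun ω => by
      rcases max_cases (w - Y ω) 0 with ⟨h, -⟩ | ⟨h, -⟩ <;> rw [h] <;>
        nlinarith [sq_nonneg (w - Y ω)])
  refine (add_le_add_left h1 _).trans ?_
  rw [← ENNReal.ofReal_add h0 (by positivity), ← ENNReal.ofReal_add (by positivity)
    (integral_nonneg fun ω => sq_nonneg _)]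
  refine ENNReal.ofReal_le_ofReal ?_
  rw [integral_add (f := fun ω => w ^ 2 - 2 * w * Y ω)
      ((integrable_const _).sub (hY.const_mul _)) hY2,
    integral_sub (integrable_const _) (hY.const_mul _), integral_const_mul]
  simp
  linarith

/-- Drift of `w ^ γ` at a level `w` so high that the first-order term, with the increment truncated
at `w`, dominates the part of the second-order term that grows with `w`. -/
lemma lintegral_rpow_lindley_step_le [IsProbabilityMeasure μ] {g c : Ω → ℝ}
    (hgm : Measurable g) (hcm : Measurable c)
    (hg : ∀ᵐ ω ∂μ, 0 ≤ g ω) (hc : ∀ᵐ ω ∂μ, 0 ≤ c ω)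
    (hY : Integrable (fun ω => g ω - c ω) μ) (hY2 : Integrable (fun ω => (g ω - c ω) ^ 2) μ)
    {γ a w : ℝ} (hγ : 2 ≤ γ) (ha : 0 < a) (hw : 0 < w)
    (hmin : 2 / 3 * a ≤ ∫ ω, min (g ω - c ω) w ∂μ)
    (hsq : 2 ^ (γ - 1) * ((γ - 1) / a) * ∫ ω, (g ω - c ω) ^ 2 ∂μ ≤ w) :
    ∫⁻ ω, ENNReal.ofReal (max (w - (g ω - c ω)) 0 ^ γ) ∂μ +
        ENNReal.ofReal (γ * a / 3 * w ^ (γ - 1)) ≤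
      ENNReal.ofReal (w ^ γ) + ENNReal.ofReal (γ * (γ - 1) * 2 ^ (γ - 3)) *
        ∫⁻ ω, ENNReal.ofReal (c ω ^ (γ - 2) * (g ω - c ω) ^ 2) ∂μ := by
  set D : ℝ := γ * (γ - 1) * 2 ^ (γ - 3) with hD
  have hDpos : 0 < D := by
    have : 0 < γ - 1 := by linarith
    positivity
  set q : Ω → ℝ := fun ω => c ω ^ (γ - 2) * (g ω - c ω) ^ 2 with hq
  have hqm : Measurable q := (hcm.pow_const _).mul ((hgm.sub hcm).pow_const 2)
  have hq0 : 0 ≤ᵐ[μ] q := hc.mono fun ω h => mul_nonneg (Real.rpow_nonneg h _) (sq_nonneg _)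
  rcases eq_or_ne (∫⁻ ω, ENNReal.ofReal (q ω) ∂μ) ⊤ with htop | htop
  · rw [htop, ENNReal.mul_top (by simpa using hDpos), add_top]
    exact le_top
  have hqi : Integrable q μ := by
    refine ⟨hqm.aestronglyMeasurable, ?_⟩
    rw [hasFiniteIntegral_iff_ofReal hq0]
    exact htop.lt_top
  rw [← ofReal_integral_eq_lintegral_ofReal hqi hq0]
  have hmini : Integrable (fun ω => min (g ω - c ω) w) μ := hY.inf (integrable_const w)
  have hi1 : Integrable (fun ω => w ^ γ - γ * w ^ (γ - 1) * min (g ω - c ω) w) μ :=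
    (integrable_const _).sub (hmini.const_mul _)
  have hi2 : Integrable (fun ω => D * w ^ (γ - 2) * (g ω - c ω) ^ 2 + D * q ω) μ :=
    (hY2.const_mul _).add (hqi.const_mul _)
  have hpt : ∀ᵐ ω ∂μ, max (w - (g ω - c ω)) 0 ^ γ ≤
      (w ^ γ - γ * w ^ (γ - 1) * min (g ω - c ω) w) +
        (D * w ^ (γ - 2) * (g ω - c ω) ^ 2 + D * q ω) := by
    filter_upwards [hg, hc] with ω h1 h2
    set Y := g ω - c ω
    have hYc : -c ω ≤ Y := by simp only [Y]; linarith
    have hu : max (w - Y) 0 = w - min Y w := by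
      rcases le_total Y w with h | h
      · rw [min_eq_left h, max_eq_left (by linarith)]
      · rw [min_eq_right h, max_eq_right (by linarith), sub_self]
    have hu0 : 0 ≤ w - min Y w := by linarith [min_le_right Y w]
    have hle : w - min Y w ≤ w + c ω := by
      have : -c ω ≤ min Y w := le_min hYc (by linarith)
      linarith
    have ht := rpow_le_taylor hγ hu0 hw.le hle (by linarith)
    have hsq' : (w - min Y w - w) ^ 2 ≤ Y ^ 2 := by
      rcases le_total Y w with h | h
      · rw [min_eq_left h]; nlinarith
      · rw [min_eq_right h]; nlinarith
    have hm := add_rpow_le_two_rpow_mul hw.le h2 (q := γ - 2) (by linarith)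
    have h23 : (2 : ℝ) ^ (γ - 2) = 2 ^ (γ - 3) * 2 := by
      rw [← Real.rpow_add_one two_ne_zero]; congr 1; ring
    have hrest : γ * (γ - 1) / 2 * (w + c ω) ^ (γ - 2) * (w - min Y w - w) ^ 2 ≤
        γ * (γ - 1) / 2 * (2 ^ (γ - 2) * (w ^ (γ - 2) + c ω ^ (γ - 2))) * Y ^ 2 := by
      have : 0 ≤ γ - 1 := by linarith
      gcongr
    rw [hu]
    calc _ ≤ _ := ht
      _ ≤ w ^ γ + γ * w ^ (γ - 1) * (w - min Y w - w) +
          γ * (γ - 1) / 2 * (2 ^ (γ - 2) * (w ^ (γ - 2) + c ω ^ (γ - 2))) * Y ^ 2 := by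
        gcongr
      _ = _ := by
        simp only [hq, hD, h23]; ring
  have hI := lintegral_ofReal_le_ofReal_integral (hi1.add hi2)
    (fun ω => Real.rpow_nonneg (le_max_right _ _) _) hpt
  have hI0 : 0 ≤ ∫ ω, ((fun ω => w ^ γ - γ * w ^ (γ - 1) * min (g ω - c ω) w) +
      fun ω => D * w ^ (γ - 2) * (g ω - c ω) ^ 2 + D * q ω) ω ∂μ :=
    integral_nonneg_of_ae (hpt.mono fun ω h => (Real.rpow_nonneg (le_max_right _ _) _).trans h)
  have hw1 : w ^ (γ - 1) = w ^ (γ - 2) * w := by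
    rw [← Real.rpow_add_one hw.ne']; congr 1; ring
  have h31 : (2 : ℝ) ^ (γ - 1) = 2 ^ (γ - 3) * 4 := by
    rw [show (4 : ℝ) = 2 ^ (2 : ℝ) by norm_num, ← Real.rpow_add two_pos]; congr 1; ring
  refine (add_le_add_left hI _).trans ?_
  rw [← ENNReal.ofReal_mul hDpos.le, ← ENNReal.ofReal_add hI0 (by positivity),
    ← ENNReal.ofReal_add (by positivity)
      (mul_nonneg hDpos.le (integral_nonneg_of_ae hq0))]
  refine ENNReal.ofReal_le_ofReal ?_
  rw [integral_add' hi1 hi2, integral_sub (integrable_const _) (hmini.const_mul _),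
    integral_add (hY2.const_mul _) (hqi.const_mul _), integral_const_mul, integral_const_mul,
    integral_const_mul]
  simp only [integral_const, probReal_univ, one_smul]
  set E2 := ∫ ω, (g ω - c ω) ^ 2 ∂μ
  set Em := ∫ ω, min (g ω - c ω) w ∂μ
  have hA : γ * w ^ (γ - 1) * (2 / 3 * a) ≤ γ * w ^ (γ - 1) * Em := by gcongr
  have hB : D * w ^ (γ - 2) * E2 ≤ γ * w ^ (γ - 1) * (a / 4) := by
    have h : (γ - 1) * 2 ^ (γ - 3) * E2 ≤ w * (a / 4) := by
      rw [h31] at hsq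
      have h2 := mul_le_mul_of_nonneg_right hsq (show 0 ≤ a / 4 by positivity)
      calc _ = 2 ^ (γ - 3) * 4 * ((γ - 1) / a) * E2 * (a / 4) := by field_simp
        _ ≤ _ := h2
    have h3 := mul_le_mul_of_nonneg_left h (show 0 ≤ γ * w ^ (γ - 2) by positivity)
    rw [hw1, hD]
    linarith
  have hC : 0 ≤ γ * w ^ (γ - 1) * a := by positivity
  linarith

/-- Drift of `w ^ γ` at a level `w ≤ s`: one step raises the level by at most the claim. -/
lemma lintegral_rpow_lindley_step_le_of_le [IsProbabilityMeasure μ] {g c : Ω → ℝ}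
    (hg : ∀ᵐ ω ∂μ, 0 ≤ g ω) (hc : ∀ᵐ ω ∂μ, 0 ≤ c ω)
    {γ s w : ℝ} (hγ : 1 ≤ γ) (hw : 0 ≤ w) (hws : w ≤ s) :
    ∫⁻ ω, ENNReal.ofReal (max (w - (g ω - c ω)) 0 ^ γ) ∂μ ≤
      ENNReal.ofReal (w ^ γ) +
        ENNReal.ofReal γ * ∫⁻ ω, ENNReal.ofReal ((s + c ω) ^ (γ - 1) * c ω) ∂μ := by
  have h : ∀ᵐ ω ∂μ, ENNReal.ofReal (max (w - (g ω - c ω)) 0 ^ γ) ≤ ENNReal.ofReal (w ^ γ) +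
      ENNReal.ofReal γ * ENNReal.ofReal ((s + c ω) ^ (γ - 1) * c ω) := by
    filter_upwards [hg, hc] with ω h1 h2
    have hs : 0 ≤ s + c ω := by linarith
    rw [← ENNReal.ofReal_mul (by linarith), ← ENNReal.ofReal_add (Real.rpow_nonneg hw _)
      (mul_nonneg (by linarith) (mul_nonneg (Real.rpow_nonneg hs _) h2))]
    refine ENNReal.ofReal_le_ofReal ?_
    have hle : max (w - (g ω - c ω)) 0 ≤ w + c ω := max_le (by linarith) (by linarith)
    have h3 := Real.rpow_le_rpow (le_max_right _ _) hle (show 0 ≤ γ by linarith)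
    have h4 := rpow_sub_rpow_le (show 0 ≤ w + c ω by linarith) hw hγ
    have h5 : (w + c ω) ^ (γ - 1) ≤ (s + c ω) ^ (γ - 1) :=
      Real.rpow_le_rpow (by linarith) (by linarith) (by linarith)
    have h6 : γ * (w + c ω) ^ (γ - 1) * (w + c ω - w) ≤ γ * ((s + c ω) ^ (γ - 1) * c ω) := by
      rw [add_sub_cancel_left, mul_assoc]
      gcongr
    linarith
  refine (lintegral_mono_ae h).trans ?_
  rw [lintegral_add_left measurable_const, lintegral_const_mul' _ _ ENNReal.ofReal_ne_top]
  simp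

end CramerLundberg

namespace CramerLundberg

variable {Ω : Type*} [MeasurableSpace Ω] {μ : Measure Ω} {G C : ℕ → Ω → ℝ}

/-! ### Bounds for the ruin probability of the surplus process -/

lemma IsModel.isIID (h : IsModel μ G C) : IsIID μ fun n ω => G n ω - C n ω where
  measurable n := (h.measurable_premium n).sub (h.measurable_claim n)
  indep := h.indep.comp (fun _ p => p.1 - p.2) fun _ => measurable_fst.sub measurable_snd
  identDistrib n := (h.identDistrib n).comp (u := fun p : ℝ × ℝ => p.1 - p.2)
    (measurable_fst.sub measurable_snd)

lemma NetProfit.integrable_increment (h : NetProfit μ G C) :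
    Integrable (fun ω => G 0 ω - C 0 ω) μ :=
  h.integrable_premium.sub h.integrable_claim

lemma NetProfit.integral_increment (h : NetProfit μ G C) :
    ∫ ω, (G 0 ω - C 0 ω) ∂μ = meanIncrement μ G C :=
  integral_sub h.integrable_premium h.integrable_claim

lemma NetProfit.exists_isAdmissible (h : NetProfit μ G C) : ∃ s₁, IsAdmissible μ G C s₁ := by
  have hY := h.integrable_increment
  have hlim : Filter.Tendsto (fun n : ℕ => ∫ ω, min (G 0 ω - C 0 ω) (n : ℝ) ∂μ) Filter.atTop
      (nhds (∫ ω, (G 0 ω - C 0 ω) ∂μ)) := by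
    refine tendsto_integral_of_dominated_convergence (fun ω => |G 0 ω - C 0 ω|)
      (fun n => hY.aestronglyMeasurable.inf aestronglyMeasurable_const) hY.abs (fun n => ?_) ?_
    · refine Filter.Eventually.of_forall fun ω => ?_
      rw [Real.norm_eq_abs]
      have hn : (0 : ℝ) ≤ n := Nat.cast_nonneg n
      rcases le_total (G 0 ω - C 0 ω) (n : ℝ) with h1 | h1
      · rw [min_eq_left h1]
      · rw [min_eq_right h1, abs_of_nonneg hn]
        exact h1.trans (le_abs_self _)
    · refine Filter.Eventually.of_forall fun ω => ?_
      obtain ⟨N, hN⟩ := exists_nat_ge (G 0 ω - C 0 ω)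
      refine tendsto_const_nhds.congr' ?_
      filter_upwards [Filter.eventually_ge_atTop N] with n hn
      rw [min_eq_left (hN.trans (Nat.cast_le.2 hn))]
  rw [h.integral_increment] at hlim
  have hpos := h.mean_pos
  obtain ⟨n, hn⟩ := (hlim.eventually_const_lt
    (show 2 / 3 * meanIncrement μ G C < meanIncrement μ G C by linarith)).exists
  exact ⟨n, hn.le⟩

lemma IsAdmissible.pos [IsProbabilityMeasure μ] {s₁ : ℝ} (hs : IsAdmissible μ G C s₁)
    (h : NetProfit μ G C) : 0 < s₁ := by
  have hle : ∫ ω, min (G 0 ω - C 0 ω) s₁ ∂μ ≤ ∫ _, s₁ ∂μ :=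
    integral_mono (h.integrable_increment.inf (integrable_const _)) (integrable_const _)
      fun ω => min_le_right _ _
  rw [integral_const, probReal_univ, one_smul] at hle
  have hpos := h.mean_pos
  have hs' : 2 / 3 * meanIncrement μ G C ≤ ∫ ω, min (G 0 ω - C 0 ω) s₁ ∂μ := hs
  linarith

/-- Near zero the ruin probability is controlled through the quadratic Lyapunov function, i.e. by
Kingman's bound for the mean of Lindley's recursion. -/
lemma ruin_mul_le_sq [IsProbabilityMeasure μ] (hmodel : IsModel μ G C) (hnpc : NetProfit μ G C)
    (hY2 : Integrable (fun ω => (G 0 ω - C 0 ω) ^ 2) μ) {y : ℝ} (hy : 0 ≤ y) :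
    ENNReal.ofReal (2 * meanIncrement μ G C * y) *
        μ {ω | ∃ k, y + ∑ i ∈ Finset.range k, (G i ω - C i ω) < 0} ≤
      ENNReal.ofReal (∫ ω, (G 0 ω - C 0 ω) ^ 2 ∂μ) := by
  have hpos := hnpc.mean_pos
  have hmean := hnpc.integral_increment
  refine hmodel.isIID.mul_measure_ruin_le (V := fun w => ENNReal.ofReal (w ^ 2))
    (f := fun w => ENNReal.ofReal (2 * meanIncrement μ G C * w)) (by fun_prop) (by fun_prop)
    (by simp) (fun w hw => ?_) hy (fun w hw => ?_)
  · have h := lintegral_sq_lindley_step_le hnpc.integrable_increment hY2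
      (by rw [hmean]; exact hpos.le) hw
    rwa [hmean] at h
  · gcongr

/-- Far from zero the ruin probability is controlled through the Lyapunov function `w ^ γ`. -/
lemma ruin_mul_le_rpow [IsProbabilityMeasure μ] (hmodel : IsModel μ G C) (hnpc : NetProfit μ G C)
    (hY2 : Integrable (fun ω => (G 0 ω - C 0 ω) ^ 2) μ) {γ s₁ y : ℝ} (hγ : 2 ≤ γ)
    (hs : IsAdmissible μ G C s₁) (hy0 : 0 < y) (hy : s3 μ G C γ s₁ ≤ y) :
    ENNReal.ofReal (γ * meanIncrement μ G C / 3 * y ^ (γ - 1)) *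
        μ {ω | ∃ k, y + ∑ i ∈ Finset.range k, (G i ω - C i ω) < 0} ≤
      max (c1 μ G C γ) (c2 μ G C γ s₁) := by
  have hpos := hnpc.mean_pos
  have hY := hnpc.integrable_increment
  refine hmodel.isIID.mul_measure_ruin_le (V := fun w => ENNReal.ofReal (w ^ γ))
    (f := (Set.Ici (s3 μ G C γ s₁)).indicator
      fun w => ENNReal.ofReal (γ * meanIncrement μ G C / 3 * w ^ (γ - 1))) (by fun_prop)
    (Measurable.indicator (by fun_prop) measurableSet_Ici)
    (by simp [Real.zero_rpow (show γ ≠ 0 by linarith)]) (fun w hw => ?_) hy0.le (fun w hw => ?_)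
  · rcases lt_or_ge w (s3 μ G C γ s₁) with hlt | hge
    · rw [Set.indicator_of_notMem (by simpa using hlt), add_zero]
      exact (lintegral_rpow_lindley_step_le_of_le (hmodel.premium_nonneg 0) (hmodel.claim_nonneg 0)
        (by linarith) hw hlt.le).trans (add_le_add_right (le_max_right _ _) _)
    · rw [Set.indicator_of_mem (Set.mem_Ici.2 hge)]
      have hs₁w : s₁ ≤ w := (le_max_left _ _).trans hge
      have hmin : 2 / 3 * meanIncrement μ G C ≤ ∫ ω, min (G 0 ω - C 0 ω) w ∂μ :=
        hs.trans (integral_mono (hY.inf (integrable_const _)) (hY.inf (integrable_const _))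
          fun ω => min_le_min_left _ hs₁w)
      exact (lintegral_rpow_lindley_step_le (hmodel.measurable_premium 0)
        (hmodel.measurable_claim 0) (hmodel.premium_nonneg 0) (hmodel.claim_nonneg 0) hY hY2 hγ
        hpos ((hs.pos hnpc).trans_le hs₁w) hmin ((le_max_right _ _).trans hge)).trans
          (add_le_add_right (le_max_left _ _) _)
  · rw [Set.indicator_of_mem (Set.mem_Ici.2 (hy.trans hw.le))]
    have : 0 ≤ γ - 1 := by linarith
    gcongr

lemma ruin_le_boundConst [IsProbabilityMeasure μ] (hmodel : IsModel μ G C)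
    (hnpc : NetProfit μ G C) (hY2 : Integrable (fun ω => (G 0 ω - C 0 ω) ^ 2) μ) {γ s₁ y : ℝ}
    (hγ : 2 ≤ γ) (hs : IsAdmissible μ G C s₁) (hy : 0 < y) :
    μ {ω | ∃ k, y + ∑ i ∈ Finset.range k, (G i ω - C i ω) < 0} ≤
      boundConst μ G C γ s₁ * ENNReal.ofReal (y ^ (1 - γ)) := by
  have ha := hnpc.mean_pos
  have hs1 := hs.pos hnpc
  set a := meanIncrement μ G C with ha_def
  have hyinv : y ^ (1 - γ) = (y ^ (γ - 1))⁻¹ := by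
    rw [← Real.rpow_neg hy.le, neg_sub]
  have hyp : 0 < y ^ (γ - 1) := Real.rpow_pos_of_pos hy _
  have hγ0 : 0 < γ := by linarith
  rw [boundConst, add_mul]
  rcases le_or_gt (s3 μ G C γ s₁) y with h | h
  · refine le_trans ?_ le_self_add
    have hK := ruin_mul_le_rpow hmodel hnpc hY2 hγ hs hy h
    rw [← ha_def] at hK ⊢
    have hKpos : 0 < γ * a / 3 * y ^ (γ - 1) := by positivity
    rw [mul_comm, ← ENNReal.le_div_iff_mul_le (Or.inl (by simpa using hKpos))
      (Or.inl ENNReal.ofReal_ne_top)] at hK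
    refine hK.trans (le_of_eq ?_)
    have h3 : (ENNReal.ofReal (γ * a / 3 * y ^ (γ - 1)))⁻¹ =
        3 * (ENNReal.ofReal (a * γ))⁻¹ * ENNReal.ofReal (y ^ (1 - γ)) := by
      rw [← ENNReal.ofReal_inv_of_pos hKpos, ← ENNReal.ofReal_inv_of_pos (by positivity),
        show (3 : ENNReal) = ENNReal.ofReal 3 by simp, ← ENNReal.ofReal_mul (by positivity),
        ← ENNReal.ofReal_mul (by positivity), hyinv]
      congr 1
      field_simp
    rw [div_eq_mul_inv, h3, div_eq_mul_inv]
    ring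
  · refine le_trans ?_ le_add_self
    have hK := ruin_mul_le_sq hmodel hnpc hY2 hy.le
    rw [← ha_def] at hK
    have hKpos : 0 < 2 * a * y := by positivity
    rw [mul_comm, ← ENNReal.le_div_iff_mul_le (Or.inl (by simpa using hKpos))
      (Or.inl ENNReal.ofReal_ne_top), ← ENNReal.ofReal_div_of_pos hKpos] at hK
    refine hK.trans ?_
    have hs3 : 0 < s3 μ G C γ s₁ := hy.trans h
    rw [← ENNReal.ofReal_mul (by positivity)]
    refine ENNReal.ofReal_le_ofReal ?_
    set E2 := ∫ ω, (G 0 ω - C 0 ω) ^ 2 ∂μ with hE2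
    have hE0 : 0 ≤ E2 := integral_nonneg fun ω => sq_nonneg _
    have h2 : 2 / a * E2 ≤ s3 μ G C γ s₁ := by
      refine le_trans ?_ (le_max_right _ _)
      have h2γ : (2 : ℝ) ≤ 2 ^ (γ - 1) := by
        simpa using Real.rpow_le_rpow_of_exponent_le (x := 2) one_le_two
          (show (1 : ℝ) ≤ γ - 1 by linarith)
      have h1a : 1 / a ≤ (γ - 1) / a := by gcongr; linarith
      have : 2 * (1 / a) ≤ 2 ^ (γ - 1) * ((γ - 1) / a) := by gcongr
      rw [s2, ← ha_def, ← hE2]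
      calc 2 / a * E2 = 2 * (1 / a) * E2 := by ring
        _ ≤ _ := by gcongr
    -- the factor `s₃ / y ≥ 1` may be raised to the power `γ - 1 ≥ 1`
    have hratio : s3 μ G C γ s₁ / y ≤ (s3 μ G C γ s₁ / y) ^ (γ - 1) := by
      simpa using Real.rpow_le_rpow_of_exponent_le ((one_le_div hy).2 h.le)
        (show (1 : ℝ) ≤ γ - 1 by linarith)
    rw [Real.div_rpow hs3.le hy.le] at hratio
    calc E2 / (2 * a * y) = (2 / a * E2) / y / 4 := by field_simp; norm_num
      _ ≤ s3 μ G C γ s₁ / y / 4 := by gcongr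
      _ ≤ 1 / 2 * (s3 μ G C γ s₁ / y) := by
        have : 0 ≤ s3 μ G C γ s₁ / y := by positivity
        linarith
      _ ≤ 1 / 2 * (s3 μ G C γ s₁ ^ (γ - 1) / y ^ (γ - 1)) := by gcongr
      _ = _ := by rw [hyinv]; ring

/-! ### Finiteness of the constant for independent premiums and claims -/

/-- If `c - g` has a finite moment and `g` is independent of `c`, then `c` has this moment: restrict
to an event `g ≤ N` of positive probability. -/
lemma lintegral_rpow_lt_top_of_indepFun [IsProbabilityMeasure μ] {g c : Ω → ℝ}
    (hgm : Measurable g) (hcm : Measurable c) (hc : ∀ᵐ ω ∂μ, 0 ≤ c ω) (hind : IndepFun g c μ)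
    {γ : ℝ} (hγ : 0 ≤ γ) (h : Integrable (fun ω => |c ω - g ω| ^ γ) μ) :
    ∫⁻ ω, ENNReal.ofReal (c ω ^ γ) ∂μ < ⊤ := by
  obtain ⟨N, hN⟩ : ∃ N : ℕ, 0 < μ {ω | g ω ≤ N} := by
    by_contra! hcon
    have h0 : μ (⋃ N : ℕ, {ω | g ω ≤ N}) = 0 :=
      measure_iUnion_null fun N => le_antisymm (hcon N) zero_le
    have hu : ⋃ N : ℕ, {ω | g ω ≤ N} = Set.univ :=
      Set.eq_univ_of_forall fun ω => Set.mem_iUnion.2 (exists_nat_ge (g ω))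
    rw [hu, measure_univ] at h0
    exact one_ne_zero h0
  set φ : ℝ → ENNReal := (Set.Iic (N : ℝ)).indicator 1 with hφ
  have hφm : Measurable φ := measurable_one.indicator measurableSet_Iic
  have hprod := lintegral_mul_eq_lintegral_mul_lintegral_of_indepFun'' (μ := μ)
    (hφm.comp hgm).aemeasurable
    (show Measurable fun ω => ENNReal.ofReal (c ω ^ γ) by fun_prop).aemeasurable
    (hind.comp hφm (show Measurable fun x : ℝ => ENNReal.ofReal (x ^ γ) by fun_prop))
  have hφI : ∫⁻ ω, (φ ∘ g) ω ∂μ = μ {ω | g ω ≤ N} := by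
    have hs : MeasurableSet {ω | g ω ≤ (N : ℝ)} := measurableSet_le hgm measurable_const
    rw [← lintegral_indicator_one hs]
    rfl
  have hfin : ∫⁻ ω, (φ ∘ g) ω * ENNReal.ofReal (c ω ^ γ) ∂μ < ⊤ := by
    have hi : Integrable (fun ω => 2 ^ γ * (|c ω - g ω| ^ γ + (N : ℝ) ^ γ)) μ :=
      (h.add (integrable_const _)).const_mul _
    refine lt_of_le_of_lt (lintegral_mono_ae ?_) hi.lintegral_lt_top
    filter_upwards [hc] with ω hω
    by_cases hgN : g ω ≤ N
    · simp only [Function.comp, hφ, Set.indicator_of_mem (Set.mem_Iic.2 hgN), Pi.one_apply, one_mul]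
      refine ENNReal.ofReal_le_ofReal ?_
      refine le_trans (Real.rpow_le_rpow hω ?_ hγ)
        (add_rpow_le_two_rpow_mul (abs_nonneg (c ω - g ω)) (Nat.cast_nonneg N) hγ)
      linarith [le_abs_self (c ω - g ω)]
    · simp [hφ, hgN]
  rw [hprod, hφI] at hfin
  by_contra hcon
  rw [not_lt_top_iff] at hcon
  rw [hcon, ENNReal.mul_top hN.ne'] at hfin
  exact lt_irrefl _ hfin

lemma boundConst_lt_top [IsProbabilityMeasure μ] (hmodel : IsModel μ G C) (hnpc : NetProfit μ G C)
    (hind : IndepFun (G 0) (C 0) μ) {γ s₁ : ℝ} (hγ : 2 ≤ γ) (hs : IsAdmissible μ G C s₁)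
    (hmoment : Integrable (fun ω => |C 0 ω - G 0 ω| ^ γ) μ) :
    boundConst μ G C γ s₁ < ⊤ := by
  have hgm := hmodel.measurable_premium 0
  have hcm := hmodel.measurable_claim 0
  have hγ0 : 0 < γ := by linarith
  have hclaim := lintegral_rpow_lt_top_of_indepFun hgm hcm (hmodel.claim_nonneg 0) hind hγ0.le
    hmoment
  have hclaimi : Integrable (fun ω => C 0 ω ^ γ) μ := by
    refine ⟨(hcm.pow_const γ).aestronglyMeasurable, ?_⟩
    rw [hasFiniteIntegral_iff_ofReal
      ((hmodel.claim_nonneg 0).mono fun ω h => Real.rpow_nonneg h _)]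
    exact hclaim
  have hs3 : 0 ≤ s3 μ G C γ s₁ := (hs.pos hnpc).le.trans (le_max_left _ _)
  have h1 : c1 μ G C γ < ⊤ := by
    refine ENNReal.mul_lt_top ENNReal.ofReal_lt_top
      (lt_of_le_of_lt (lintegral_mono_ae ?_) (hclaimi.add hmoment).lintegral_lt_top)
    filter_upwards [hmodel.claim_nonneg 0] with ω h
    refine ENNReal.ofReal_le_ofReal ?_
    simp only [Pi.add_apply]
    set d := |C 0 ω - G 0 ω| with hd
    have hd0 : 0 ≤ d := abs_nonneg _
    have hdsq : (G 0 ω - C 0 ω) ^ 2 = d ^ 2 := by rw [hd, sq_abs]; ring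
    have hpow : ∀ t : ℝ, 0 ≤ t → t ^ γ = t ^ (γ - 2) * t ^ 2 := fun t ht => by
      rw [← Real.rpow_two, ← Real.rpow_add_of_nonneg ht (by linarith) (by norm_num)]
      congr 1; ring
    rw [hdsq]
    have hCγ := Real.rpow_nonneg h γ
    have hdγ := Real.rpow_nonneg hd0 γ
    rcases le_total d (C 0 ω) with hle | hle
    · have : C 0 ω ^ (γ - 2) * d ^ 2 ≤ C 0 ω ^ (γ - 2) * C 0 ω ^ 2 := by gcongr
      rw [← hpow _ h] at this
      linarith
    · have : C 0 ω ^ (γ - 2) * d ^ 2 ≤ d ^ (γ - 2) * d ^ 2 := by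
        have : 0 ≤ γ - 2 := by linarith
        gcongr
      rw [← hpow _ hd0] at this
      linarith
  have h2 : c2 μ G C γ s₁ < ⊤ := by
    have hi : Integrable (fun ω => 2 ^ γ * (s3 μ G C γ s₁ ^ γ + C 0 ω ^ γ)) μ :=
      ((integrable_const _).add hclaimi).const_mul _
    refine ENNReal.mul_lt_top ENNReal.ofReal_lt_top
      (lt_of_le_of_lt (lintegral_mono_ae ?_) hi.lintegral_lt_top)
    filter_upwards [hmodel.claim_nonneg 0] with ω h
    refine ENNReal.ofReal_le_ofReal ?_
    refine le_trans ?_ (add_rpow_le_two_rpow_mul hs3 h hγ0.le)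
    have hsum : 0 ≤ s3 μ G C γ s₁ + C 0 ω := by positivity
    calc (s3 μ G C γ s₁ + C 0 ω) ^ (γ - 1) * C 0 ω
        ≤ (s3 μ G C γ s₁ + C 0 ω) ^ (γ - 1) * (s3 μ G C γ s₁ + C 0 ω) ^ (1 : ℝ) := by
          rw [Real.rpow_one]
          gcongr
          linarith
      _ = (s3 μ G C γ s₁ + C 0 ω) ^ γ := by
          rw [← Real.rpow_add_of_nonneg hsum (by linarith) zero_le_one]
          congr 1; ring
  have hden : ENNReal.ofReal (meanIncrement μ G C * γ) ≠ 0 := by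
    simpa using mul_pos hnpc.mean_pos hγ0
  exact ENNReal.add_lt_top.2 ⟨ENNReal.div_lt_top
    (ENNReal.mul_ne_top (by norm_num) (max_lt h1 h2).ne) hden, ENNReal.ofReal_lt_top⟩

end CramerLundberg

theorem mainTheorem3 {Ω : Type*} [MeasurableSpace Ω] (μ : Measure Ω) [IsProbabilityMeasure μ]
    (G C : ℕ → Ω → ℝ) (hmodel : CramerLundberg.IsModel μ G C)
    (hnpc : CramerLundberg.NetProfit μ G C)
    (hunbdd : ∀ x : ℝ, 0 < x → cdf (μ.map (C 0)) x < 1)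
    (γ : ℝ) (hγ : 2 ≤ γ)
    (hmoment : Integrable (fun ω => |C 0 ω - G 0 ω| ^ γ) μ) :
    (∃ s₁ : ℝ, CramerLundberg.IsAdmissible μ G C s₁) ∧
    ∀ s₁ : ℝ, CramerLundberg.IsAdmissible μ G C s₁ →
      (IndepFun (G 0) (C 0) μ → CramerLundberg.boundConst μ G C γ s₁ < ⊤) ∧
      ∀ z y : ℝ, 0 < z → 0 < y →
        ENNReal.ofReal |CramerLundberg.ruinProb μ G C z -
            (1 - CramerLundberg.twoBarrierProb μ G C z y)| ≤
          CramerLundberg.boundConst μ G C γ s₁ * ENNReal.ofReal (y ^ (1 - γ)) ∧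
        ENNReal.ofReal |CramerLundberg.ruinProb μ G C z -
            (1 - CramerLundberg.twoBarrierProbStrict μ G C z y)| ≤
          CramerLundberg.boundConst μ G C γ s₁ * ENNReal.ofReal (y ^ (1 - γ)) := by
  have hY2 : Integrable (fun ω => (G 0 ω - C 0 ω) ^ 2) μ := by
    refine (CramerLundberg.integrable_sq_of_integrable_abs_rpow
      ((hmodel.measurable_claim 0).sub (hmodel.measurable_premium 0)) hγ hmoment).congr
        (Filter.Eventually.of_forall fun ω => ?_)
    simp only [Pi.sub_apply]
    ring
  refine ⟨hnpc.exists_isAdmissible, fun s₁ hs => ⟨fun hind =>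
    CramerLundberg.boundConst_lt_top hmodel hnpc hind hγ hs hmoment, fun z y _ hy => ?_⟩⟩
  have hmean : 0 < ∫ ω, (G 0 ω - C 0 ω) ∂μ := hnpc.integral_increment ▸ hnpc.mean_pos
  have hruin := CramerLundberg.ruin_le_boundConst hmodel hnpc hY2 hγ hs hy
  exact ⟨(CramerLundberg.abs_ruinProb_sub_le hmodel.isIID hnpc.integrable_increment hmean z y
      measurableSet_Ici subset_rfl Set.Ioi_subset_Ici_self).trans hruin,
    (CramerLundberg.abs_ruinProb_sub_le hmodel.isIID hnpc.integrable_increment hmean z y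
      measurableSet_Ioi Set.Ioi_subset_Ici_self subset_rfl).trans hruin⟩
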